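/- Let $d \ge 2$ and $r_* > 0$. Let $\Gamma$ be the set of all configurations in $\mathbb{R}^d$, that is, of all subsets $\gamma \subset \mathbb{R}^d$ with $|\gamma \cap K| < \infty$ for every compact $K \subset \mathbb{R}^d$. Equip $\Gamma$ with the vague topology, i.e. the weakest topology for which $\gamma \mapsto \sum_{x \in \gamma} f(x)$ is continuous for every continuous compactly supported $f : \mathbb{R}^d \to \mathbb{R}$, and let $\mathcal{B}(\Gamma)$ be its Borel $\sigma$-field. For $\lambda > 0$ let $\pi_\lambda$ be the homogeneous Poisson measure on $(\Gamma, \mathcal{B}(\Gamma))$ with intensity $\lambda$, i.e. the probability measure under which, for every bounded Borel set $\Lambda$, the number $|\gamma \cap \Lambda|$ is Poisson distributed with mean $\lambda$ times the Lebesgue measure of $\Lambda$, and the numbers of points in finitely many pairwise disjoint bounded Borel sets are independent. For $\gamma \in \Gamma$ let $\varepsilon_\gamma$ be the set of all pairs $\{x,y\} \subset \gamma$ with $x \ne y$ and $|x-y| \le r_*$, and let $n_\gamma(x)$ be the number of $y \in \gamma \setminus \{x\}$ with $|x-y| \le r_*$. For $\alpha, \theta > 0$ set $w_\alpha(x) =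 e^{-\alpha |x|}$ and $$a_\gamma(\alpha,\theta) = \sum_{\{x,y\} \in \varepsilon_\gamma} [w_\alpha(x) + w_\alpha(y)]\,[n_\gamma(x) n_\gamma(y)]^\theta, \qquad b_\gamma(\alpha) = \sum_{x \in \gamma} w_\alpha(x),$$ both with values in $[0,+\infty]$. Let $$A_1 = \{\gamma \in \Gamma : a_\gamma(\alpha,\theta) < \infty \text{ for all } \alpha, \theta > 0\} \cap \{\gamma \in \Gamma : b_\gamma(\alpha) < \infty \text{ for all } \alpha > 0\}.$$ Then $A_1 \in \mathcal{B}(\Gamma)$, and $\pi_\lambda(A_1) = 1$ for every $\lambda > 0$. -/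

import Mathlib

open MeasureTheory ProbabilityTheory

/-- A configuration in `ℝ^d`: a subset with finitely many points in every compact set. -/
def Configuration (d : ℕ) : Type :=
  {γ : Set (EuclideanSpace ℝ (Fin d)) //
    ∀ K : Set (EuclideanSpace ℝ (Fin d)), IsCompact K → (γ ∩ K).Finite}

namespace Configuration

/-- The set of points of a configuration. -/
def points {d : ℕ} (γ : Configuration d) : Set (EuclideanSpace ℝ (Fin d)) := γ.val

/-- The linear statistic `γ ↦ ∑_{x ∈ γ} f x`; for `f` with compact support the sum has only finitely
many nonzero terms. -/
noncomputable def linearStatistic {d : ℕ} (f : EuclideanSpace ℝ (Fin d) → ℝ)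
    (γ : Configuration d) : ℝ :=
  ∑' x : γ.points, f x

/-- The vague topology: the coarsest one that makes the linear statistic of every continuous
function with compact support continuous. -/
noncomputable instance vagueTopology (d : ℕ) : TopologicalSpace (Configuration d) :=
  ⨅ f : {f : EuclideanSpace ℝ (Fin d) → ℝ // Continuous f ∧ HasCompactSupport f},
    TopologicalSpace.induced (linearStatistic f.val) inferInstance

/-- The Borel `σ`-field of the vague topology. -/
noncomputable instance borelField (d : ℕ) : MeasurableSpace (Configuration d) := borel (Configuration d)

instance borelSpace (d : ℕ) : BorelSpace (Configuration d) := ⟨rfl⟩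

/-- The number of points of `γ` in `B`, a natural number when `B` is bounded. -/
noncomputable def count {d : ℕ} (B : Set (EuclideanSpace ℝ (Fin d))) (γ : Configuration d) : ℕ :=
  (γ.points ∩ B).ncard

/-- `P` is the law of the homogeneous Poisson point process with intensity `lam`: the number of
points in a bounded Borel set `B` is Poisson distributed with mean `lam * |B|`, where `|B|` is the
Lebesgue measure, and the numbers of points in pairwise disjoint bounded Borel sets are
independent. -/
structure IsHomogeneousPoisson {d : ℕ} (lam : ℝ) (P : Measure (Configuration d)) : Prop where
  isProbabilityMeasure : IsProbabilityMeasure P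
  count_law : ∀ B : Set (EuclideanSpace ℝ (Fin d)), MeasurableSet B → Bornology.IsBounded B →
    HasLaw (count B) (poissonMeasure (lam * volume.real B).toNNReal) P
  count_indep : ∀ (k : ℕ) (B : Fin k → Set (EuclideanSpace ℝ (Fin d))),
    (∀ i, MeasurableSet (B i)) → (∀ i, Bornology.IsBounded (B i)) →
    Pairwise (fun i j => Disjoint (B i) (B j)) →
    iIndepFun (fun i => count (B i)) P

/-- The Gilbert graph on the points of `γ`: distinct points are adjacent iff their distance is at
most `r`. -/
def gilbertGraph {d : ℕ} (r : ℝ) (γ : Configuration d) : SimpleGraph γ.points where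
  Adj x y := x ≠ y ∧ ‖(x : EuclideanSpace ℝ (Fin d)) - y‖ ≤ r
  symm := ⟨fun x y h => ⟨h.1.symm, by rw [norm_sub_rev]; exact h.2⟩⟩
  loopless := ⟨fun _ h => h.1 rfl⟩

/-- The number of neighbours of `x` in the Gilbert graph (always finite). -/
noncomputable def neighborCount {d : ℕ} (r : ℝ) (γ : Configuration d) (x : γ.points) : ℕ :=
  ((gilbertGraph r γ).neighborSet x).ncard

/-- The weight `exp (-α |x|)`. -/
noncomputable def weight {d : ℕ} (α : ℝ) (x : EuclideanSpace ℝ (Fin d)) : ℝ :=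
  Real.exp (-α * ‖x‖)

/-- The contribution `(w_α x + w_α y) (n x * n y) ^ θ` of the pair `{x, y}`. -/
noncomputable def edgeTerm {d : ℕ} (r α θ : ℝ) (γ : Configuration d) : Sym2 γ.points → ℝ :=
  Sym2.lift ⟨fun x y => (weight α x.val + weight α y.val) *
      ((neighborCount r γ x : ℝ) * (neighborCount r γ y : ℝ)) ^ θ,
    fun x y => by
      simp only [add_comm (weight α x.val), mul_comm (neighborCount r γ x : ℝ)]⟩

/-- `a_γ(α, θ)`: the sum of the edge contributions over all edges, in `[0, ∞]`. -/
noncomputable def degreeSum {d : ℕ} (r α θ : ℝ) (γ : Configuration d) : ENNReal :=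
  ∑' e : (gilbertGraph r γ).edgeSet, ENNReal.ofReal (edgeTerm r α θ γ e.val)

/-- `b_γ(α)`: the sum of the weights of all points, in `[0, ∞]`. -/
noncomputable def weightSum {d : ℕ} (α : ℝ) (γ : Configuration d) : ENNReal :=
  ∑' x : γ.points, ENNReal.ofReal (weight α x.val)

/-- The configurations with `a_γ(α, θ) < ∞` for all positive `α`, `θ`. -/
def finiteDegreeSumSet (d : ℕ) (r : ℝ) : Set (Configuration d) :=
  {γ | ∀ α : ℝ, 0 < α → ∀ θ : ℝ, 0 < θ → degreeSum r α θ γ < ⊤}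

/-- The configurations with `b_γ(α) < ∞` for all positive `α`. -/
def finiteWeightSumSet (d : ℕ) : Set (Configuration d) :=
  {γ | ∀ α : ℝ, 0 < α → weightSum α γ < ⊤}

/-- The set `A₁` of sparse configurations. -/
def sparseSet (d : ℕ) (r : ℝ) : Set (Configuration d) :=
  finiteDegreeSumSet d r ∩ finiteWeightSumSet d

end Configuration

/-! Finite weight sums already force finite degree sums. If `S = b_γ(β)` is finite, then a point `x`
has at most `S * exp (β (|x| + r))` neighbours, so degrees grow at an exponential rate as small as
desired. On an edge both weights are `O(exp (-α/2 (|x| + |y|)))`, and half of this decay absorbs the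
degree factor. Hence `a_γ(α, θ) ≤ C * b_γ(α/4)^2`, and `A₁` is the set where every `b_γ(α)` is
finite (`sparseSet_eq_finiteWeightSumSet`).

That set is Borel because `b_γ(α)` is a supremum of continuous linear statistics. It has full
measure because `b_γ(α)` has finite mean: ball volumes grow polynomially and the weights decay
exponentially. -/

/-- The mean of the Poisson distribution. -/
theorem ProbabilityTheory.lintegral_natCast_poissonMeasure (r : NNReal) :
    ∫⁻ n : ℕ, (n : ENNReal) ∂(poissonMeasure r) = r := by
  -- Size-biasing: `(n + 1) p(n + 1) = r p(n)`, so the mean is `r` times the total mass.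
  have hshift : ∀ n : ℕ, ENNReal.ofReal (Real.exp (-r) * r ^ (n + 1) / (n + 1).factorial) *
      ((n + 1 : ℕ) : ENNReal) = r * poissonMeasure r {n} := by
    intro n
    rw [poissonMeasure_singleton, ← ENNReal.ofReal_natCast (n + 1),
      ← ENNReal.ofReal_mul (by positivity), ← ENNReal.ofReal_coe_nnreal (p := r),
      ← ENNReal.ofReal_mul (by positivity)]
    congr 1
    rw [Nat.factorial_succ]
    push_cast
    have : (n.factorial : ℝ) ≠ 0 := by positivity
    field_simp
    ring
  rw [lintegral_countable', tsum_eq_zero_add' ENNReal.summable]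
  simp only [Nat.cast_zero, zero_mul, zero_add]
  calc ∑' n : ℕ, ((n + 1 : ℕ) : ENNReal) * poissonMeasure r {n + 1}
      = ∑' n : ℕ, r * poissonMeasure r {n} := by
        refine tsum_congr fun n => ?_
        rw [← hshift n, poissonMeasure_singleton, mul_comm]
    _ = r := by
        rw [ENNReal.tsum_mul_left]
        have h := lintegral_countable' (μ := poissonMeasure r) (fun _ => (1 : ENNReal))
        simp only [lintegral_const, measure_univ, one_mul] at h
        rw [← h, mul_one]

namespace Configuration

variable {d : ℕ}

theorem weight_pos (α : ℝ) (x : EuclideanSpace ℝ (Fin d)) : 0 < weight α x := Real.exp_pos _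

/-! ### Finite weight sums imply finite degree sums -/

/-- Each neighbour of `x` has norm at most `‖x‖ + r`, so it contributes at least the exponential
factor to the weight sum. -/
theorem neighborCount_mul_le {r β : ℝ} (hβ : 0 < β) (γ : Configuration d) (x : γ.points) :
    (neighborCount r γ x : ENNReal) * ENNReal.ofReal (Real.exp (-β * (‖x.val‖ + r))) ≤
      weightSum β γ := by
  set N := (gilbertGraph r γ).neighborSet x with hN
  set c := ENNReal.ofReal (Real.exp (-β * (‖x.val‖ + r)))
  calc (neighborCount r γ x : ENNReal) * c
      ≤ ENat.card N * c := by
        gcongr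
        exact_mod_cast Set.ncard_le_encard N
    _ = ∑' _ : N, c := (ENNReal.tsum_const c).symm
    _ ≤ ∑' y : N, ENNReal.ofReal (weight β y.val.val) := by
        refine ENNReal.tsum_le_tsum fun y => ENNReal.ofReal_le_ofReal (Real.exp_le_exp.2 ?_)
        have hy : ‖x.val - y.val.val‖ ≤ r := y.2.2
        have : ‖y.val.val‖ ≤ ‖x.val‖ + r := by
          have := norm_sub_norm_le y.val.val x.val
          rw [norm_sub_rev] at this
          linarith
        nlinarith
    _ ≤ weightSum β γ :=
        ENNReal.tsum_comp_le_tsum_of_injective Subtype.val_injective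
          fun y : γ.points => ENNReal.ofReal (weight β y.val)

theorem neighborCount_le {r β : ℝ} (hβ : 0 < β) {γ : Configuration d}
    (h : weightSum β γ < ⊤) (x : γ.points) :
    (neighborCount r γ x : ℝ) ≤ (weightSum β γ).toReal * Real.exp (β * (‖x.val‖ + r)) := by
  have h1 := ENNReal.toReal_mono h.ne (neighborCount_mul_le (r := r) hβ γ x)
  rw [ENNReal.toReal_mul, ENNReal.toReal_natCast, ENNReal.toReal_ofReal (Real.exp_pos _).le,
    neg_mul, Real.exp_neg] at h1
  rwa [← div_eq_mul_inv, div_le_iff₀ (Real.exp_pos _)] at h1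

/-- Along an edge, each of the two norms is at least `(‖x‖ + ‖y‖ - r) / 2`. -/
theorem weight_add_weight_le {r α : ℝ} (hα : 0 < α) {x y : EuclideanSpace ℝ (Fin d)}
    (hxy : ‖x - y‖ ≤ r) :
    weight α x + weight α y ≤ 2 * Real.exp (α / 2 * r) * Real.exp (-(α / 2) * (‖x‖ + ‖y‖)) := by
  have h1 := norm_sub_norm_le x y
  have h2 := norm_sub_norm_le y x
  rw [norm_sub_rev] at h2
  rw [mul_assoc, ← Real.exp_add, two_mul]
  refine add_le_add (Real.exp_le_exp.2 ?_) (Real.exp_le_exp.2 ?_) <;> nlinarith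

theorem exists_edgeTerm_le {r α θ : ℝ} (hα : 0 < α) (hθ : 0 < θ) {γ : Configuration d}
    (h : γ ∈ finiteWeightSumSet d) :
    ∃ C : ℝ, 0 ≤ C ∧ ∀ x y : γ.points, (gilbertGraph r γ).Adj x y →
      edgeTerm r α θ γ s(x, y) ≤ C * (weight (α / 4) x.val * weight (α / 4) y.val) := by
  -- Raising to the power `θ` turns the rate `β` into `α / 4`, half of the decay rate `α / 2`
  -- available on an edge.
  set β := α / (4 * θ) with hβdef
  have hβ : 0 < β := by positivity
  set S := (weightSum β γ).toReal
  have hS : 0 ≤ S := ENNReal.toReal_nonneg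
  refine ⟨2 * Real.exp (α / 2 * r) * ((S * S) ^ θ * Real.exp (α / 2 * r)), by positivity,
    fun x y hxy => ?_⟩
  have hx := neighborCount_le (r := r) hβ (h β hβ) x
  have hy := neighborCount_le (r := r) hβ (h β hβ) y
  have hprod : ((neighborCount r γ x : ℝ) * neighborCount r γ y) ^ θ ≤
      (S * S) ^ θ * Real.exp (α / 2 * r) * Real.exp (α / 4 * (‖x.val‖ + ‖y.val‖)) := by
    calc ((neighborCount r γ x : ℝ) * neighborCount r γ y) ^ θ
        ≤ ((S * Real.exp (β * (‖x.val‖ + r))) * (S * Real.exp (β * (‖y.val‖ + r)))) ^ θ := by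
          gcongr
      _ = ((S * S) * Real.exp (β * (‖x.val‖ + r) + β * (‖y.val‖ + r))) ^ θ := by
          rw [Real.exp_add]; ring_nf
      _ = (S * S) ^ θ * Real.exp (α / 2 * r + α / 4 * (‖x.val‖ + ‖y.val‖)) := by
          rw [Real.mul_rpow (by positivity) (Real.exp_pos _).le, ← Real.exp_mul]
          congr 2
          rw [hβdef]
          field_simp
          ring
      _ = _ := by rw [Real.exp_add]; ring
  calc edgeTerm r α θ γ s(x, y)
      = (weight α x.val + weight α y.val) *
        ((neighborCount r γ x : ℝ) * neighborCount r γ y) ^ θ := rfl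
    _ ≤ (2 * Real.exp (α / 2 * r) * Real.exp (-(α / 2) * (‖x.val‖ + ‖y.val‖))) *
        ((S * S) ^ θ * Real.exp (α / 2 * r) * Real.exp (α / 4 * (‖x.val‖ + ‖y.val‖))) :=
        mul_le_mul (weight_add_weight_le hα hxy.2) hprod (by positivity) (by positivity)
    _ = 2 * Real.exp (α / 2 * r) * ((S * S) ^ θ * Real.exp (α / 2 * r)) *
        Real.exp (-(α / 2) * (‖x.val‖ + ‖y.val‖) + α / 4 * (‖x.val‖ + ‖y.val‖)) := by
        rw [Real.exp_add]; ring
    _ = _ := by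
        rw [weight, weight, ← Real.exp_add]
        ring_nf

theorem finiteWeightSumSet_subset_finiteDegreeSumSet (d : ℕ) (r : ℝ) :
    finiteWeightSumSet d ⊆ finiteDegreeSumSet d r := by
  intro γ h α hα θ hθ
  obtain ⟨C, hC, hle⟩ := exists_edgeTerm_le (r := r) hα hθ h
  set w : γ.points → ENNReal := fun x => ENNReal.ofReal (weight (α / 4) x.val)
  -- Choosing an order on each edge embeds the edges into pairs of points, where the product bound
  -- factorises.
  have hinj : Function.Injective
      fun e : (gilbertGraph r γ).edgeSet => (Quot.out e.val : γ.points × γ.points) := by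
    intro e f hef
    rw [Subtype.ext_iff, ← Quot.out_eq e.val, ← Quot.out_eq f.val]
    exact congrArg _ hef
  have hw : weightSum (α / 4) γ < ⊤ := h _ (by positivity)
  calc degreeSum r α θ γ
      ≤ ∑' e : (gilbertGraph r γ).edgeSet,
          ENNReal.ofReal C * (w (Quot.out e.val).1 * w (Quot.out e.val).2) := by
        refine ENNReal.tsum_le_tsum fun e => ?_
        have he : s((Quot.out e.val).1, (Quot.out e.val).2) = e.val := Quot.out_eq e.val
        have hadj := e.2
        rw [← he, SimpleGraph.mem_edgeSet] at hadj
        have := hle _ _ hadj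
        rw [he] at this
        rw [← ENNReal.ofReal_mul (weight_pos _ _).le, ← ENNReal.ofReal_mul hC]
        exact ENNReal.ofReal_le_ofReal this
    _ ≤ ∑' p : γ.points × γ.points, ENNReal.ofReal C * (w p.1 * w p.2) :=
        ENNReal.tsum_comp_le_tsum_of_injective hinj
          fun p => ENNReal.ofReal C * (w p.1 * w p.2)
    _ = ENNReal.ofReal C * (weightSum (α / 4) γ * weightSum (α / 4) γ) := by
        rw [ENNReal.tsum_mul_left, ENNReal.tsum_prod (f := fun x y => w x * w y)]
        simp only [ENNReal.tsum_mul_left, ENNReal.tsum_mul_right]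
        rfl
    _ < ⊤ := ENNReal.mul_lt_top ENNReal.ofReal_lt_top (ENNReal.mul_lt_top hw hw)

theorem sparseSet_eq_finiteWeightSumSet (d : ℕ) (r : ℝ) :
    sparseSet d r = finiteWeightSumSet d :=
  Set.inter_eq_right.2 (finiteWeightSumSet_subset_finiteDegreeSumSet d r)

/-! ### Measurability -/

theorem weightSum_anti {α β : ℝ} (h : α ≤ β) (γ : Configuration d) :
    weightSum β γ ≤ weightSum α γ := by
  refine ENNReal.tsum_le_tsum fun x => ENNReal.ofReal_le_ofReal (Real.exp_le_exp.2 ?_)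
  nlinarith [norm_nonneg x.val]

/-- Monotonicity in `α` leaves only countably many conditions. -/
theorem finiteWeightSumSet_eq_iInter (d : ℕ) :
    finiteWeightSumSet d = ⋂ k : ℕ, {γ | weightSum (1 / ((k : ℝ) + 1)) γ < ⊤} := by
  ext γ
  simp only [Set.mem_iInter, Set.mem_ofPred_eq]
  refine ⟨fun h k => h _ (by positivity), fun h α hα => ?_⟩
  obtain ⟨k, hk⟩ := exists_nat_one_div_lt hα
  exact (weightSum_anti hk.le γ).trans_lt (h k)

theorem finite_points_inter_of_isBounded (γ : Configuration d)
    {B : Set (EuclideanSpace ℝ (Fin d))} (hB : Bornology.IsBounded B) :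
    (γ.points ∩ B).Finite :=
  (γ.2 _ hB.isCompact_closure).subset (Set.inter_subset_inter_right _ subset_closure)

theorem ofReal_linearStatistic {f : EuclideanSpace ℝ (Fin d) → ℝ} (hf : ∀ x, 0 ≤ f x)
    (hc : HasCompactSupport f) (γ : Configuration d) :
    ENNReal.ofReal (linearStatistic f γ) = ∑' x : γ.points, ENNReal.ofReal (f x) := by
  refine ENNReal.ofReal_tsum_of_nonneg (fun _ => hf _) (summable_of_hasFiniteSupport ?_)
  refine Set.Finite.of_finite_image ((γ.2 _ hc).subset ?_) Subtype.val_injective.injOn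
  rintro _ ⟨x, hx, rfl⟩
  exact ⟨x.2, subset_tsupport f hx⟩

theorem continuous_linearStatistic {f : EuclideanSpace ℝ (Fin d) → ℝ} (hf : Continuous f)
    (hc : HasCompactSupport f) : Continuous (linearStatistic f) :=
  continuous_iff_le_induced.2
    (iInf_le (fun f : {f : EuclideanSpace ℝ (Fin d) → ℝ // Continuous f ∧ HasCompactSupport f} =>
      TopologicalSpace.induced (linearStatistic f.val) inferInstance) ⟨f, hf, hc⟩)

/-- The weight, cut off continuously outside the ball of radius `k`. -/
noncomputable def cutoffWeight (α : ℝ) (k : ℕ) (x : EuclideanSpace ℝ (Fin d)) : ℝ :=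
  weight α x * max 0 (min 1 ((k : ℝ) + 1 - ‖x‖))

theorem cutoffWeight_nonneg (α : ℝ) (k : ℕ) (x : EuclideanSpace ℝ (Fin d)) :
    0 ≤ cutoffWeight α k x :=
  mul_nonneg (weight_pos α x).le (le_max_left _ _)

theorem cutoffWeight_le (α : ℝ) (k : ℕ) (x : EuclideanSpace ℝ (Fin d)) :
    cutoffWeight α k x ≤ weight α x :=
  mul_le_of_le_one_right (weight_pos α x).le (max_le zero_le_one (min_le_left _ _))

theorem monotone_cutoffWeight (α : ℝ) :
    Monotone (cutoffWeight α : ℕ → EuclideanSpace ℝ (Fin d) → ℝ) := by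
  intro k l hkl x
  have : (k : ℝ) ≤ l := by exact_mod_cast hkl
  have := (weight_pos α x).le
  unfold cutoffWeight
  gcongr

theorem cutoffWeight_eq {α : ℝ} {k : ℕ} {x : EuclideanSpace ℝ (Fin d)} (h : ‖x‖ ≤ k) :
    cutoffWeight α k x = weight α x := by
  rw [cutoffWeight, min_eq_left (by linarith), max_eq_right zero_le_one, mul_one]

theorem continuous_cutoffWeight (α : ℝ) (k : ℕ) :
    Continuous (cutoffWeight α k : EuclideanSpace ℝ (Fin d) → ℝ) := by
  unfold cutoffWeight weight
  fun_prop

theorem hasCompactSupport_cutoffWeight (α : ℝ) (k : ℕ) :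
    HasCompactSupport (cutoffWeight α k : EuclideanSpace ℝ (Fin d) → ℝ) := by
  refine HasCompactSupport.intro (isCompact_closedBall 0 ((k : ℝ) + 1)) fun x hx => ?_
  rw [mem_closedBall_zero_iff, not_le] at hx
  rw [cutoffWeight, max_eq_left (min_le_of_right_le (by linarith)), mul_zero]

theorem weightSum_eq_iSup (α : ℝ) (γ : Configuration d) :
    weightSum α γ = ⨆ k : ℕ, ENNReal.ofReal (linearStatistic (cutoffWeight α k) γ) := by
  -- Sums become integrals against counting measure, so monotone convergence applies to the cutoffs.
  let _ : MeasurableSpace γ.points := ⊤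
  simp only [ofReal_linearStatistic (cutoffWeight_nonneg α _) (hasCompactSupport_cutoffWeight α _),
    weightSum, ← lintegral_count]
  rw [← lintegral_iSup (f := fun k (x : γ.points) => ENNReal.ofReal (cutoffWeight α k x.val))
    (fun _ => measurable_from_top) (fun k l hkl x => ENNReal.ofReal_le_ofReal (monotone_cutoffWeight α hkl _))]
  refine lintegral_congr fun x => le_antisymm ?_ ?_
  · obtain ⟨k, hk⟩ := exists_nat_ge ‖x.val‖
    exact le_iSup_of_le k (by rw [cutoffWeight_eq hk])
  · exact iSup_le fun k => ENNReal.ofReal_le_ofReal (cutoffWeight_le α k _)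

theorem measurable_weightSum (α : ℝ) : Measurable (weightSum (d := d) α) := by
  rw [funext (weightSum_eq_iSup α)]
  exact Measurable.iSup fun k => ENNReal.measurable_ofReal.comp
    (continuous_linearStatistic (continuous_cutoffWeight α k)
      (hasCompactSupport_cutoffWeight α k)).measurable

theorem measurableSet_finiteWeightSumSet (d : ℕ) : MeasurableSet (finiteWeightSumSet d) := by
  rw [finiteWeightSumSet_eq_iInter]
  exact MeasurableSet.iInter fun k => measurable_weightSum _ measurableSet_Iio

/-! ### The Poisson process -/

theorem tsum_indicator_eq_count (γ : Configuration d) {B : Set (EuclideanSpace ℝ (Fin d))}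
    (hB : Bornology.IsBounded B) :
    ∑' x : γ.points, B.indicator (1 : EuclideanSpace ℝ (Fin d) → ENNReal) x = count B γ := by
  rw [tsum_subtype γ.points (B.indicator (1 : EuclideanSpace ℝ (Fin d) → ENNReal)),
    Set.indicator_indicator, ← tsum_subtype]
  have h := finite_points_inter_of_isBounded γ hB
  simp only [Pi.one_apply]
  rw [ENNReal.tsum_set_one, count, ← h.cast_ncard_eq]
  rfl

/-- The term `n = ⌊‖x‖⌋` alone dominates the weight of `x`; counting `x` again in larger balls is
harmless for an upper bound. -/
theorem weightSum_le_tsum_count {α : ℝ} (hα : 0 < α) (γ : Configuration d) :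
    weightSum α γ ≤ ∑' n : ℕ, ENNReal.ofReal (Real.exp (-α * n)) *
      count (Metric.closedBall 0 ((n : ℝ) + 1)) γ := by
  simp only [← tsum_indicator_eq_count γ Metric.isBounded_closedBall, ← ENNReal.tsum_mul_left]
  rw [ENNReal.tsum_comm]
  refine ENNReal.tsum_le_tsum fun x => ?_
  refine le_trans ?_ (ENNReal.le_tsum ⌊‖x.val‖⌋₊)
  rw [Set.indicator_of_mem (mem_closedBall_zero_iff.2 (Nat.lt_floor_add_one _).le),
    Pi.one_apply, mul_one]
  refine ENNReal.ofReal_le_ofReal (Real.exp_le_exp.2 ?_)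
  nlinarith [Nat.floor_le (norm_nonneg x.val)]

theorem IsHomogeneousPoisson.aemeasurable_count {lam : ℝ} {P : Measure (Configuration d)}
    (hP : IsHomogeneousPoisson lam P) {B : Set (EuclideanSpace ℝ (Fin d))}
    (hB : MeasurableSet B) (hb : Bornology.IsBounded B) :
    AEMeasurable (fun γ => (count B γ : ENNReal)) P :=
  Measurable.of_discrete.comp_aemeasurable (hP.count_law B hB hb).aemeasurable

theorem IsHomogeneousPoisson.lintegral_count_eq {lam : ℝ} {P : Measure (Configuration d)}
    (hP : IsHomogeneousPoisson lam P) {B : Set (EuclideanSpace ℝ (Fin d))}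
    (hB : MeasurableSet B) (hb : Bornology.IsBounded B) :
    ∫⁻ γ, (count B γ : ENNReal) ∂P = ENNReal.ofReal (lam * volume.real B) := by
  rw [(hP.count_law B hB hb).lintegral_comp (f := fun n : ℕ => (n : ENNReal))
    Measurable.of_discrete.aemeasurable, lintegral_natCast_poissonMeasure]
  rfl

theorem summable_exp_mul_volume_closedBall (d : ℕ) {α : ℝ} (hα : 0 < α) (lam : ℝ) :
    Summable fun n : ℕ => Real.exp (-α * n) *
      (lam * volume.real (Metric.closedBall (0 : EuclideanSpace ℝ (Fin d)) ((n : ℝ) + 1))) := by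
  -- The volume is a constant times `(n + 1) ^ d`; shifting the exponential to `n + 1` costs a
  -- factor `exp α`.
  have h := (summable_nat_add_iff 1).2 (Real.summable_pow_mul_exp_neg_nat_mul d hα)
  refine (h.mul_left (Real.exp α * lam *
    volume.real (Metric.ball (0 : EuclideanSpace ℝ (Fin d)) 1))).congr fun n => ?_
  rw [measureReal_def, measureReal_def, Measure.addHaar_closedBall _ _ (by positivity), ENNReal.toReal_mul,
    ENNReal.toReal_ofReal (by positivity), finrank_euclideanSpace_fin]
  have : Real.exp (-α * n) = Real.exp α * Real.exp (-α * (n + 1 : ℕ)) := by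
    rw [← Real.exp_add]
    push_cast
    ring_nf
  rw [this]
  push_cast
  ring

theorem IsHomogeneousPoisson.lintegral_weightSum_lt_top {lam : ℝ}
    {P : Measure (Configuration d)} (hP : IsHomogeneousPoisson lam P) {α : ℝ} (hα : 0 < α) :
    ∫⁻ γ, weightSum α γ ∂P < ⊤ := by
  refine (lintegral_mono (weightSum_le_tsum_count hα)).trans_lt ?_
  have hm : ∀ n : ℕ, AEMeasurable (fun γ =>
      (count (Metric.closedBall (0 : EuclideanSpace ℝ (Fin d)) ((n : ℝ) + 1)) γ : ENNReal)) P :=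
    fun n => hP.aemeasurable_count measurableSet_closedBall Metric.isBounded_closedBall
  rw [lintegral_tsum fun n => (hm n).const_mul _]
  simp only [lintegral_const_mul'' _ (hm _), hP.lintegral_count_eq measurableSet_closedBall
    Metric.isBounded_closedBall, ← ENNReal.ofReal_mul (Real.exp_pos _).le]
  exact (summable_exp_mul_volume_closedBall d hα lam).tsum_ofReal_lt_top

theorem IsHomogeneousPoisson.measure_finiteWeightSumSet {lam : ℝ}
    {P : Measure (Configuration d)} (hP : IsHomogeneousPoisson lam P) :
    P (finiteWeightSumSet d) = 1 := by
  have := hP.isProbabilityMeasure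
  rw [← prob_compl_eq_zero_iff (measurableSet_finiteWeightSumSet d)]
  change ∀ᵐ γ ∂P, γ ∈ finiteWeightSumSet d
  rw [finiteWeightSumSet_eq_iInter]
  simp only [Set.mem_iInter]
  exact ae_all_iff.2 fun k => ae_lt_top (measurable_weightSum _)
    (hP.lintegral_weightSum_lt_top (by positivity)).ne

end Configuration

theorem proposition3 (d : ℕ) (hd : 2 ≤ d) (r : ℝ) (hr : 0 < r) :
    MeasurableSet (Configuration.sparseSet d r) ∧
      ∀ lam : ℝ, 0 < lam → ∀ P : Measure (Configuration d),
        Configuration.IsHomogeneousPoisson lam P → P (Configuration.sparseSet d r) = 1 := by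
  rw [Configuration.sparseSet_eq_finiteWeightSumSet]
  exact ⟨Configuration.measurableSet_finiteWeightSumSet d,
    fun _ _ _ hP => hP.measure_finiteWeightSumSet⟩
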